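/- **Proposition (The rate of convergence of the Lasso).** Let $\mathbf X\in\mathbb R^{n\times p}$ be a fixed (non-random) design matrix whose columns $X_{(1)},\dots,X_{(p)}$ satisfy $\frac1n X_{(j)}^TX_{(j)}=1$, let $\beta^*\in\mathbb R^p$, and let $Y=\mathbf X\beta^*+\varepsilon$ with $\varepsilon=(\varepsilon_1,\dots,\varepsilon_n)^T$. Let $\sigma>0$ and suppose that either $\varepsilon_1,\dots,\varepsilon_n$ are i.i.d. $N(0,\sigma^2)$, or $\varepsilon_1/\sigma,\dots,\varepsilon_n/\sigma$ are i.i.d. with mean zero and a $2$-strongly log-concave density on $\mathbb R$. Here a density $f$ is called $\kappa$-strongly log-concave if $\log f(tx+(1-t)y)\ge t\log f(x)+(1-t)\log f(y)+\frac{\kappa}{2}t(1-t)|x-y|^2$ for all $x,y$ and $t\in[0,1]$ (with $\log 0=-\infty$). Let $A>0$ and $\lambda=A\sigma\sqrt{(\log p)/n}$, and let $\hat\beta$ be any Lasso estimate, i.e. any minimizer over $\beta\in\mathbb R^p$ of $$\frac1{2n}\|Y-\mathbf X\beta\|_2^2+\lambda\|\beta\|_1 .$$ Put $S=\{j:\beta^*_j\neq0\}$,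 $s=|S|$, and $C(3,S)=\{b\in\mathbb R^p:\|b_{S^c}\|_1\le3\|b_S\|_1\}$. 1. If the KKT condition $\|\frac1n\mathbf X^T(Y-\mathbf X\beta^*)\|_\infty\le\lambda/2$ holds, then $\hat\beta-\beta^*\in C(3,S)$. 2. Let $A>2\sqrt2$ and suppose that the restricted eigenvalue condition $$\mathrm{RE}:=\inf_{0\ne b\in C(3,S)}\frac{\big(b^T\,\tfrac1n\mathbf X^T\mathbf X\,b\big)^{1/2}}{\|b\|_2}\ \ge\ \gamma>0$$ holds with a real number $\gamma$ (for instance $\gamma=\mathrm{RE}$ when $0<\mathrm{RE}<\infty$; $\inf\emptyset=+\infty$). Then, with probability at least $1-2p^{1-A^2/8}$, the KKT condition in 1 holds and, simultaneously for all Lasso estimates $\hat\beta$, $$\|\hat\beta-\beta^*\|_1\le\frac{3A\sigma}{\gamma^2}\,s\sqrt{\frac{\log p}{n}},\qquad \|\hat\beta-\beta^*\|_2^2\le\frac{9A^2\sigma^2}{\gamma^4}\,\frac{s\log p}{n},\qquad \frac1n\|\mathbf X(\hat\beta-\beta^*)\|_2^2\le\frac{9A^2\sigma^2}{\gamma^2}\,\frac{s\log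 p}{n}.$$ -/

import Mathlib

open MeasureTheory ProbabilityTheory Matrix

/-- A nonnegative function `f` is `γ`-strongly log-concave:
`log f (t x + (1 - t) y) ≥ t log f x + (1 - t) log f y + (γ / 2) t (1 - t) ‖x - y‖ ^ 2`,
written multiplicatively so that `f` may vanish (`log 0 = -∞`). -/
def StronglyLogConcave {E : Type*} [NormedAddCommGroup E] [NormedSpace ℝ E]
    (γ : ℝ) (f : E → ℝ) : Prop :=
  (∀ x, 0 ≤ f x) ∧
    ∀ x y : E, ∀ t : ℝ, 0 ≤ t → t ≤ 1 →
      f x ^ t * f y ^ (1 - t) * Real.exp (γ / 2 * (t * (1 - t)) * ‖x - y‖ ^ 2)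
        ≤ f (t • x + (1 - t) • y)

/-- A `γ`-strongly log-concave distribution: a probability measure with a `γ`-strongly
log-concave Lebesgue density. -/
def IsStronglyLogConcaveLaw {E : Type*} [NormedAddCommGroup E] [NormedSpace ℝ E]
    [MeasureSpace E] (γ : ℝ) (ν : Measure E) : Prop :=
  IsProbabilityMeasure ν ∧
    ∃ f : E → ℝ, Measurable f ∧ StronglyLogConcave γ f ∧
      ν = volume.withDensity (fun x => ENNReal.ofReal (f x))

section Lasso

variable {n p : ℕ}

/-- The `ℓ₁` norm on `ℝ^m`. -/
def l1Norm {m : ℕ} (b : Fin m → ℝ) : ℝ := ∑ j, |b j|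

/-- The squared Euclidean norm on `ℝ^m`. -/
def sqL2Norm {m : ℕ} (b : Fin m → ℝ) : ℝ := ∑ j, b j ^ 2

/-- The support `S(β) = {j : β_j ≠ 0}`. -/
noncomputable def coefSupport (β : Fin p → ℝ) : Finset (Fin p) :=
  Finset.univ.filter (fun j => β j ≠ 0)

/-- The cone `C(η, S) = {b : ‖b_{Sᶜ}‖₁ ≤ η ‖b_S‖₁}`. -/
def lassoCone (η : ℝ) (S : Finset (Fin p)) : Set (Fin p → ℝ) :=
  {b | ∑ j ∈ Sᶜ, |b j| ≤ η * ∑ j ∈ S, |b j|}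

/-- The restricted eigenvalue
`RE(η, S, Σ) = inf {(bᵀ Σ b)^{1/2} / ‖b‖₂ : 0 ≠ b ∈ C(η, S)}`, an extended real number
(it is `+∞` when the cone is `{0}`). -/
noncomputable def restrictedEigenvalue (η : ℝ) (S : Finset (Fin p))
    (M : Matrix (Fin p) (Fin p) ℝ) : EReal :=
  ⨅ b : Fin p → ℝ, ⨅ _ : b ≠ 0 ∧ b ∈ lassoCone η S,
    ((Real.sqrt (b ⬝ᵥ (M *ᵥ b)) / Real.sqrt (sqL2Norm b) : ℝ) : EReal)

/-- The Gram matrix `(1/n) Xᵀ X = (1/n) ∑ᵢ Xᵢ Xᵢᵀ`, where `Xᵢ` is the `i`-th row of `X`. -/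
noncomputable def gramMatrix (X : Matrix (Fin n) (Fin p) ℝ) : Matrix (Fin p) (Fin p) ℝ :=
  (1 / (n : ℝ)) • (Xᵀ * X)

/-- `b` is a Lasso estimate: a minimizer of `β ↦ ‖y - X β‖₂² / (2 n) + lam ‖β‖₁`. -/
def IsLassoEstimate (X : Matrix (Fin n) (Fin p) ℝ) (y : Fin n → ℝ) (lam : ℝ)
    (b : Fin p → ℝ) : Prop :=
  ∀ β : Fin p → ℝ,
    1 / (2 * (n : ℝ)) * sqL2Norm (y - X *ᵥ b) + lam * l1Norm b
      ≤ 1 / (2 * (n : ℝ)) * sqL2Norm (y - X *ᵥ β) + lam * l1Norm β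

/-- The KKT condition at `β`: `‖Xᵀ (y - X β) / n‖_∞ ≤ lam / 2`
(the norm of `Fin p → ℝ` in Mathlib is the maximum norm). -/
def KKTCondition (X : Matrix (Fin n) (Fin p) ℝ) (y : Fin n → ℝ) (lam : ℝ)
    (β : Fin p → ℝ) : Prop :=
  ‖(1 / (n : ℝ)) • (Xᵀ *ᵥ (y - X *ᵥ β))‖ ≤ lam / 2

end Lasso

/-! Both kinds of noise are sub-Gaussian with variance proxy `σ ^ 2`. For log-concave noise, the
second derivative of the cumulant generating function is the variance of an exponentially tilted
law. Tilting preserves strong log-concavity, and every `γ`-strongly log-concave law has variance at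
most `2 / γ` (`IsStronglyLogConcaveLaw.variance_le`). This is weaker than the sharp `1 / γ`, but for
`γ = 2` it gives exactly 1. A Hoeffding bound and a union over the columns then yield the KKT event.

On that event everything is deterministic. Strong convexity doubles the quadratic term in the usual
Lasso comparison (`IsLassoEstimate.sqL2Norm_le`); KKT controls the noise term, giving
`IsLassoEstimate.basic_inequality`. Cone membership follows on dropping the prediction error, and
the rates follow from Cauchy-Schwarz on the support and the restricted eigenvalue.

The limit lemma below closes each argument that degenerates at the endpoint 1. -/

theorem le_of_forall_mem_Ioo_le_of_continuous {F : ℝ → ℝ} {c : ℝ} (hF : Continuous F)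
    (h : ∀ t ∈ Set.Ioo (0 : ℝ) 1, F t ≤ c) : F 1 ≤ c := by
  have : (nhdsWithin (1 : ℝ) (Set.Ioo 0 1)).NeBot := right_nhdsWithin_Ioo_neBot one_pos
  exact le_of_tendsto ((hF.tendsto 1).mono_left nhdsWithin_le_nhds)
    (eventually_nhdsWithin_of_forall h)

/-! ### Strongly log-concave densities on the line -/

section StronglyLogConcave

variable {γ : ℝ} {f : ℝ → ℝ}

theorem StronglyLogConcave.min_le_of_mem_Icc (hf : StronglyLogConcave γ f) (hγ : 0 ≤ γ)
    {a b y c : ℝ} (hab : a < b) (hy : y ∈ Set.Icc a b) (hc : 0 ≤ c) (ha : c ≤ f a)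
    (hb : c ≤ f b) : c ≤ f y := by
  have hba : 0 < b - a := sub_pos.2 hab
  set t := (b - y) / (b - a) with ht
  have ht0 : 0 ≤ t := div_nonneg (by linarith [hy.2]) hba.le
  have ht1 : t ≤ 1 := (div_le_one hba).2 (by linarith [hy.1])
  have h := hf.2 a b t ht0 ht1
  have hpt : t • a + (1 - t) • b = y := by
    simp only [smul_eq_mul, ht]; field_simp; ring
  rw [hpt] at h
  refine le_trans ?_ h
  have hexp : 1 ≤ Real.exp (γ / 2 * (t * (1 - t)) * ‖a - b‖ ^ 2) := by
    have : 0 ≤ 1 - t := by linarith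
    exact Real.one_le_exp (by positivity)
  calc c = c ^ t * c ^ (1 - t) := by
        rw [← Real.rpow_add_of_nonneg hc ht0 (by linarith)]; simp
    _ ≤ f a ^ t * f b ^ (1 - t) := by
        have : 0 ≤ f a := hf.1 a
        gcongr
    _ ≤ _ := le_mul_of_one_le_right
        (mul_nonneg (Real.rpow_nonneg (hf.1 _) _) (Real.rpow_nonneg (hf.1 _) _)) hexp

theorem StronglyLogConcave.midpoint_sq_le (hf : StronglyLogConcave γ f) (x y : ℝ) :
    f x * f y * Real.exp (γ / 4 * (x - y) ^ 2) ≤ f ((x + y) / 2) ^ 2 := by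
  have h := hf.2 x y (1 / 2) (by norm_num) (by norm_num)
  have hpt : (1 / 2 : ℝ) • x + (1 - 1 / 2 : ℝ) • y = (x + y) / 2 := by
    simp only [smul_eq_mul]; ring
  rw [hpt] at h
  have h0 : 0 ≤ f x ^ (1 / 2 : ℝ) * f y ^ (1 - 1 / 2 : ℝ) *
      Real.exp (γ / 2 * (1 / 2 * (1 - 1 / 2)) * ‖x - y‖ ^ 2) :=
    mul_nonneg (mul_nonneg (Real.rpow_nonneg (hf.1 _) _) (Real.rpow_nonneg (hf.1 _) _))
      (Real.exp_pos _).le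
  refine le_trans (le_of_eq ?_) (pow_le_pow_left₀ h0 h 2)
  rw [mul_pow, mul_pow, ← Real.rpow_natCast (f x ^ _), ← Real.rpow_natCast (f y ^ _),
    ← Real.rpow_mul (hf.1 _), ← Real.rpow_mul (hf.1 _), ← Real.exp_nat_mul]
  norm_num
  left
  ring

/-- A high value at any `x`, averaged with an interval where `f ≥ c > 0`, forces `f ≥ √(f x * c)` on
an interval of fixed length `(b - a) / 2`; the finite integral limits this. -/
theorem StronglyLogConcave.bddAbove_range (hf : StronglyLogConcave γ f) (hγ : 0 ≤ γ)
    (hint : Integrable f) (hpos : 0 < ∫ x, f x) : BddAbove (Set.range f) := by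
  obtain ⟨a, b, hab, hfa, hfb⟩ : ∃ a b, a < b ∧ 0 < f a ∧ 0 < f b := by
    have hsupp : 0 < volume (Function.support f) :=
      (integral_pos_iff_support_of_nonneg hf.1 hint).1 hpos
    have hns : (Function.support f).Nontrivial := by
      by_contra h
      rw [Set.not_nontrivial_iff] at h
      exact hsupp.ne' (h.measure_zero volume)
    obtain ⟨a, ha, b, hb, hab⟩ := hns.exists_lt
    exact ⟨a, b, hab, (hf.1 a).lt_of_ne' ha, (hf.1 b).lt_of_ne' hb⟩
  set c := min (f a) (f b)
  have hc : 0 < c := lt_min hfa hfb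
  have hba : 0 < b - a := sub_pos.2 hab
  refine ⟨(2 * (∫ x, f x) / (b - a)) ^ 2 / c, ?_⟩
  rintro _ ⟨x, rfl⟩
  have hlow : ∀ z ∈ Set.Icc ((x + a) / 2) ((x + b) / 2), Real.sqrt (f x * c) ≤ f z := by
    intro z hz
    have hy : c ≤ f (2 * z - x) := hf.min_le_of_mem_Icc hγ hab
      ⟨by linarith [hz.1], by linarith [hz.2]⟩ hc.le (min_le_left _ _) (min_le_right _ _)
    have h := hf.midpoint_sq_le x (2 * z - x)
    rw [show (x + (2 * z - x)) / 2 = z by ring] at h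
    refine Real.sqrt_le_iff.2 ⟨hf.1 z, le_trans ?_ h⟩
    refine le_trans (mul_le_mul_of_nonneg_left hy (hf.1 x)) ?_
    exact le_mul_of_one_le_right (mul_nonneg (hf.1 _) (hf.1 _)) (Real.one_le_exp (by positivity))
  have hI : Real.sqrt (f x * c) * ((b - a) / 2) ≤ ∫ x, f x := by
    calc Real.sqrt (f x * c) * ((b - a) / 2)
        = ∫ _ in Set.Icc ((x + a) / 2) ((x + b) / 2), Real.sqrt (f x * c) := by
          rw [setIntegral_const, Real.volume_real_Icc_of_le (by linarith), smul_eq_mul]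
          ring
      _ ≤ ∫ z in Set.Icc ((x + a) / 2) ((x + b) / 2), f z :=
          setIntegral_mono_on (integrableOn_const (by simp)) hint.integrableOn
            measurableSet_Icc hlow
      _ ≤ ∫ z, f z := setIntegral_le_integral hint (Filter.Eventually.of_forall hf.1)
  have hs : Real.sqrt (f x * c) ≤ 2 * (∫ x, f x) / (b - a) := by
    rw [le_div_iff₀ hba]; linarith
  rw [le_div_iff₀ hc, ← Real.sq_sqrt (mul_nonneg (hf.1 x) hc.le)]
  exact pow_le_pow_left₀ (Real.sqrt_nonneg _) hs 2

/-- The midpoint inequality against a fixed `m` with `f m > 0`, together with boundedness, gives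
Gaussian decay, which beats any exponential. -/
theorem StronglyLogConcave.integrable_mul_exp (hf : StronglyLogConcave γ f) (hγ : 0 < γ)
    (hint : Integrable f) (hpos : 0 < ∫ x, f x) (u : ℝ) :
    Integrable fun x => f x * Real.exp (u * x) := by
  obtain ⟨M, hM⟩ := hf.bddAbove_range hγ.le hint hpos
  replace hM : ∀ x, f x ≤ M := fun x => hM ⟨x, rfl⟩
  obtain ⟨m, hm⟩ : ∃ m, 0 < f m := by
    by_contra! h
    exact hpos.not_ge (integral_nonpos h)
  have hdom : Integrable fun x => M ^ 2 / f m * Real.exp (u * m + u ^ 2 * 2 / γ) *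
      Real.exp (-(γ / 8) * (x - m) ^ 2) :=
    ((integrable_exp_neg_mul_sq (b := γ / 8) (by positivity)).comp_sub_right m).const_mul _
  refine hdom.mono' (hint.aestronglyMeasurable.mul (by fun_prop)) (Filter.Eventually.of_forall ?_)
  intro x
  rw [Real.norm_of_nonneg (mul_nonneg (hf.1 x) (Real.exp_pos _).le)]
  have h1 : f x ≤ M ^ 2 / f m * Real.exp (-(γ / 4 * (x - m) ^ 2)) := by
    have h := (hf.midpoint_sq_le x m).trans (pow_le_pow_left₀ (hf.1 _) (hM _) 2)
    rw [Real.exp_neg, ← div_eq_mul_inv, div_div, le_div_iff₀ (by positivity)]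
    linarith
  -- Half of the Gaussian exponent absorbs the linear term by completing the square.
  have h2 : u * x + -(γ / 4 * (x - m) ^ 2) ≤ (u * m + u ^ 2 * 2 / γ) + -(γ / 8) * (x - m) ^ 2 := by
    have : u * m + u ^ 2 * 2 / γ + -(γ / 8) * (x - m) ^ 2 - (u * x + -(γ / 4 * (x - m) ^ 2))
        = γ / 8 * (x - m - 4 * u / γ) ^ 2 := by
      field_simp; ring
    nlinarith [mul_nonneg hγ.le (sq_nonneg (x - m - 4 * u / γ))]
  calc f x * Real.exp (u * x)
      ≤ M ^ 2 / f m * Real.exp (-(γ / 4 * (x - m) ^ 2)) * Real.exp (u * x) := by gcongr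
    _ = M ^ 2 / f m * Real.exp (u * x + -(γ / 4 * (x - m) ^ 2)) := by
        rw [Real.exp_add]; ring
    _ ≤ M ^ 2 / f m * Real.exp ((u * m + u ^ 2 * 2 / γ) + -(γ / 8) * (x - m) ^ 2) := by gcongr
    _ = _ := by rw [Real.exp_add]; ring

theorem StronglyLogConcave.const_mul_mul_exp (hf : StronglyLogConcave γ f) {c : ℝ} (hc : 0 < c)
    (u : ℝ) : StronglyLogConcave γ fun x => f x * (Real.exp (u * x) / c) := by
  have hw : ∀ x : ℝ, Real.exp (u * x) / c = Real.exp (u * x - Real.log c) := fun x => by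
    rw [Real.exp_sub, Real.exp_log hc]
  simp only [hw]
  refine ⟨fun x => mul_nonneg (hf.1 x) (Real.exp_pos _).le, fun x y t ht0 ht1 => ?_⟩
  rw [Real.mul_rpow (hf.1 x) (Real.exp_pos _).le, Real.mul_rpow (hf.1 y) (Real.exp_pos _).le,
    ← Real.exp_mul, ← Real.exp_mul]
  calc _ = f x ^ t * f y ^ (1 - t) * Real.exp (γ / 2 * (t * (1 - t)) * ‖x - y‖ ^ 2) *
        Real.exp (u * (t • x + (1 - t) • y) - Real.log c) := by
        rw [show u * (t • x + (1 - t) • y) - Real.log c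
          = (u * x - Real.log c) * t + (u * y - Real.log c) * (1 - t) by
            simp only [smul_eq_mul]; ring, Real.exp_add]
        ring
    _ ≤ _ := mul_le_mul_of_nonneg_right (hf.2 x y t ht0 ht1) (Real.exp_pos _).le

/-- Comparing a strongly log-concave density with its dilation around a near-mode `m`. -/
theorem StronglyLogConcave.le_dilation (hf : StronglyLogConcave γ f)
    {m δ : ℝ} (hδ : 0 < δ) (hδ1 : δ ≤ 1) (hm : ∀ x, δ * f x ≤ f m)
    {t : ℝ} (ht0 : 0 < t) (ht1 : t < 1) (x : ℝ) :
    δ * (f x * (1 + γ / 2 * (t * (1 - t)) * (x - m) ^ 2)) ≤ f (t * x + (1 - t) * m) := by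
  have h := hf.2 x m t ht0.le ht1.le
  simp only [smul_eq_mul, Real.norm_eq_abs, sq_abs] at h
  refine le_trans ?_ h
  have h1t : 0 ≤ 1 - t := by linarith
  have hfx := hf.1 x
  have hδt : δ ≤ δ ^ (1 - t) := by
    simpa using Real.rpow_le_rpow_of_exponent_ge hδ hδ1 (by linarith : 1 - t ≤ 1)
  have h1 : δ * f x ≤ f x ^ t * f m ^ (1 - t) :=
    calc δ * f x ≤ δ ^ (1 - t) * f x := by gcongr
      _ = δ ^ (1 - t) * (f x ^ t * f x ^ (1 - t)) := by
          rw [← Real.rpow_add_of_nonneg hfx ht0.le h1t]; simp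
      _ = f x ^ t * (δ * f x) ^ (1 - t) := by rw [Real.mul_rpow hδ.le hfx]; ring
      _ ≤ f x ^ t * f m ^ (1 - t) := by
          have := hm x
          gcongr
  calc _ = δ * f x * (γ / 2 * (t * (1 - t)) * (x - m) ^ 2 + 1) := by ring
    _ ≤ δ * f x * Real.exp (γ / 2 * (t * (1 - t)) * (x - m) ^ 2) := by
        gcongr; exact Real.add_one_le_exp _
    _ ≤ _ := by gcongr

end StronglyLogConcave

/-! ### Tilting, variance and the moment generating function of a strongly log-concave law -/

section Law

variable {γ : ℝ} {ν : Measure ℝ}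

theorem integral_withDensity_ofReal {f : ℝ → ℝ} (hf : Measurable f) (h0 : ∀ x, 0 ≤ f x)
    (g : ℝ → ℝ) :
    ∫ x, g x ∂(volume.withDensity fun x => ENNReal.ofReal (f x)) = ∫ x, f x * g x := by
  rw [integral_withDensity_eq_integral_toReal_smul (by fun_prop) (by simp)]
  simp [ENNReal.toReal_ofReal, h0]

theorem integrable_withDensity_ofReal_iff {f : ℝ → ℝ} (hf : Measurable f) (h0 : ∀ x, 0 ≤ f x)
    (g : ℝ → ℝ) :
    Integrable g (volume.withDensity fun x => ENNReal.ofReal (f x)) ↔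
      Integrable fun x => f x * g x := by
  rw [integrable_withDensity_iff_integrable_smul' (by fun_prop) (by simp)]
  simp [ENNReal.toReal_ofReal, h0]

theorem IsStronglyLogConcaveLaw.integrable_exp_mul (hν : IsStronglyLogConcaveLaw γ ν)
    (hγ : 0 < γ) (u : ℝ) : Integrable (fun x => Real.exp (u * x)) ν := by
  obtain ⟨hP, f, hfm, hf, rfl⟩ := hν
  have hint : Integrable f := by
    simpa using (integrable_withDensity_ofReal_iff hfm hf.1 fun _ => 1).1 (integrable_const 1)
  have h1 : ∫ x, f x = 1 := by
    simpa using (integral_withDensity_ofReal hfm hf.1 fun _ => 1).symm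
  exact (integrable_withDensity_ofReal_iff hfm hf.1 _).2
    (hf.integrable_mul_exp hγ hint (by rw [h1]; exact one_pos) u)

theorem IsStronglyLogConcaveLaw.tilted (hν : IsStronglyLogConcaveLaw γ ν) (hγ : 0 < γ) (u : ℝ) :
    IsStronglyLogConcaveLaw γ (ν.tilted fun x => u * x) := by
  have hexp := hν.integrable_exp_mul hγ u
  have := hν.1
  refine ⟨isProbabilityMeasure_tilted hexp, ?_⟩
  have hZ : 0 < ∫ x, Real.exp (u * x) ∂ν := integral_exp_pos hexp
  obtain ⟨_, f, hfm, hf, hνf⟩ := hν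
  refine ⟨_, ?_, hf.const_mul_mul_exp hZ u, ?_⟩
  · fun_prop
  · rw [Measure.tilted]
    nth_rewrite 1 [hνf]
    rw [← withDensity_mul _ (by fun_prop) (by fun_prop)]
    congr 1
    ext x
    rw [Pi.mul_apply, ENNReal.ofReal_mul (hf.1 x)]

theorem IsStronglyLogConcaveLaw.memLp_two (hν : IsStronglyLogConcaveLaw γ ν) (hγ : 0 < γ) :
    MemLp id 2 ν := by
  refine memLp_of_mem_interior_integrableExpSet ?_ 2
  simp [integrableExpSet, hν.integrable_exp_mul hγ]

/-- Dilating around a near-mode changes the total mass from 1 to `1 / t`, while `le_dilation` bounds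
the dilated density below by a second moment. The factor `δ` avoids having to know that the supremum
is attained. -/
theorem IsStronglyLogConcaveLaw.variance_le (hν : IsStronglyLogConcaveLaw γ ν) (hγ : 0 < γ) :
    Var[id; ν] ≤ 2 / γ := by
  have hL2 := hν.memLp_two hγ
  obtain ⟨hP, f, hfm, hf, hνf⟩ := hν
  have hint : Integrable f := by
    simpa using (integrable_withDensity_ofReal_iff hfm hf.1 fun _ => 1).1
      (hνf ▸ integrable_const 1)
  have h1 : ∫ x, f x = 1 := by
    simpa [hνf.symm] using (integral_withDensity_ofReal hfm hf.1 fun _ => 1).symm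
  have hbdd := hf.bddAbove_range hγ.le hint (by rw [h1]; exact one_pos)
  have hB : 0 < ⨆ x, f x := by
    by_contra! h
    have : ∫ x, f x ≤ 0 := integral_nonpos fun x => (le_ciSup hbdd x).trans h
    linarith
  have key : ∀ t : ℝ, 0 < t → t < 1 → ∀ δ : ℝ, 0 < δ → δ < 1 →
      δ * (1 + γ / 2 * (t * (1 - t)) * Var[id; ν]) ≤ 1 / t := by
    intro t ht0 ht1 δ hδ0 hδ1
    obtain ⟨m, hm⟩ := exists_lt_of_lt_ciSup (mul_lt_of_lt_one_left hB hδ1)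
    have hm' : ∀ x, δ * f x ≤ f m := fun x =>
      (mul_le_mul_of_nonneg_left (le_ciSup hbdd x) hδ0.le).trans hm.le
    have hsq : Integrable (fun x => (x - m) ^ 2) ν := by
      have := (hL2.sub (memLp_const m)).integrable_sq
      simpa using this
    have hsq' : Integrable fun x => f x * (x - m) ^ 2 :=
      (integrable_withDensity_ofReal_iff hfm hf.1 _).1 (hνf ▸ hsq)
    have hvar : Var[id; ν] ≤ ∫ x, f x * (x - m) ^ 2 := by
      rw [← integral_withDensity_ofReal hfm hf.1, ← hνf,
        ← variance_sub_const hL2.aestronglyMeasurable m]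
      exact variance_le_expectation_sq (by fun_prop)
    have hdil : ∫ x, f (t * x + (1 - t) * m) = 1 / t := by
      have := Measure.integral_comp_mul_left (fun x => f (x + (1 - t) * m)) t
      rw [this, integral_add_right_eq_self, h1, abs_of_pos (inv_pos.2 ht0)]
      simp
    have hdilint : Integrable fun x => f (t * x + (1 - t) * m) :=
      (hint.comp_add_right ((1 - t) * m)).comp_mul_left' ht0.ne'
    have hk : 0 ≤ γ / 2 * (t * (1 - t)) := by
      have : 0 < 1 - t := by linarith
      positivity
    have heq : (fun x => f x * (1 + γ / 2 * (t * (1 - t)) * (x - m) ^ 2))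
        = fun x => f x + γ / 2 * (t * (1 - t)) * (f x * (x - m) ^ 2) := by
      ext x; ring
    calc δ * (1 + γ / 2 * (t * (1 - t)) * Var[id; ν])
        ≤ δ * (1 + γ / 2 * (t * (1 - t)) * ∫ x, f x * (x - m) ^ 2) := by gcongr
      _ = ∫ x, δ * (f x * (1 + γ / 2 * (t * (1 - t)) * (x - m) ^ 2)) := by
          rw [integral_const_mul, heq, integral_add hint (hsq'.const_mul _), h1,
            integral_const_mul]
      _ ≤ ∫ x, f (t * x + (1 - t) * m) := by
          refine integral_mono ?_ hdilint fun x => hf.le_dilation hδ0 hδ1.le hm' ht0 ht1 x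
          refine Integrable.const_mul ?_ δ
          rw [heq]
          exact hint.add (hsq'.const_mul _)
      _ = 1 / t := hdil
  -- With `δ → 1`, the excess `1 - t` of mass cancels against the factor `1 - t` in front of the
  -- variance.
  have key2 : ∀ t : ℝ, 0 < t → t < 1 → t ^ 2 * (γ / 2 * Var[id; ν]) ≤ 1 := by
    intro t ht0 ht1
    have h := le_of_forall_mem_Ioo_le_of_continuous (by fun_prop) fun δ hδ =>
      key t ht0 ht1 δ hδ.1 hδ.2
    rw [one_mul] at h
    rw [le_div_iff₀ ht0] at h
    have h1t : 0 < 1 - t := by linarith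
    nlinarith
  have hlim := le_of_forall_mem_Ioo_le_of_continuous (by fun_prop) fun t ht =>
    key2 t ht.1 ht.2
  rw [le_div_iff₀ hγ]
  linarith

/-- A centred `γ`-strongly log-concave law is sub-Gaussian with variance proxy `2 / γ`. -/
theorem IsStronglyLogConcaveLaw.hasSubgaussianMGF (hν : IsStronglyLogConcaveLaw γ ν) (hγ : 0 < γ)
    (hmean : ∫ x, x ∂ν = 0) : HasSubgaussianMGF id (2 / γ).toNNReal ν where
  integrable_exp_mul := hν.integrable_exp_mul hγ
  mgf_le s := by
    have := hν.1
    have hexp : ∀ u : ℝ, Integrable (fun x => Real.exp (u * (s * x))) ν := fun u => by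
      simpa [mul_assoc] using hν.integrable_exp_mul hγ (u * s)
    have huniv : interior (integrableExpSet (fun x => s * x) ν) = Set.univ := by
      simp [integrableExpSet, hexp]
    have hmean' : ∫ x, s * x ∂ν = 0 := by rw [integral_const_mul, hmean, mul_zero]
    -- Second-order Taylor expansion at 0. Rescaling by `s` and evaluating at 1 treats both signs of
    -- `s` at once.
    obtain ⟨u, -, h⟩ := exists_cgf_eq_iteratedDeriv_two_cgf_mul (X := fun x => s * x) (μ := ν)
      one_pos hmean' (by simp [huniv])
    have hv := (hν.tilted hγ (u * s)).variance_le hγ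
    rw [← variance_tilted_mul (by simp [huniv]), variance_const_mul] at h
    simp only [mul_assoc] at hv
    have hmgf : mgf id ν s = Real.exp (cgf (fun x => s * x) ν 1) := by
      rw [exp_cgf (hexp 1)]; simp [mgf]
    rw [hmgf, h, Real.exp_le_exp, Real.coe_toNNReal _ (by positivity)]
    have : s ^ 2 * Var[fun x => x; ν.tilted fun x => u * (s * x)] ≤ s ^ 2 * (2 / γ) := by
      gcongr
      exact hv
    linarith

end Law

/-! ### Sub-Gaussian noise and tail bounds -/

section Noise

variable {Ω : Type*} [MeasurableSpace Ω] {P : Measure Ω}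

theorem hasSubgaussianMGF_of_hasLaw_gaussianReal {Z : Ω → ℝ} {v : NNReal}
    (hZ : HasLaw Z (gaussianReal 0 v) P) : HasSubgaussianMGF Z v P := by
  rw [← HasSubgaussianMGF.id_map_iff hZ.aemeasurable, hZ.map_eq]
  refine ⟨integrable_exp_mul_gaussianReal, fun t => ?_⟩
  rw [mgf_id_gaussianReal]
  simp

theorem hasSubgaussianMGF_of_hasLaw_stronglyLogConcave {Z : Ω → ℝ} {σ γ : ℝ} (hσ : σ ≠ 0)
    (hγ : 0 < γ) {ν : Measure ℝ} (hν : IsStronglyLogConcaveLaw γ ν) (hmean : ∫ x, x ∂ν = 0)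
    (hZ : HasLaw (fun ω => Z ω / σ) ν P) :
    HasSubgaussianMGF Z (σ ^ 2 * (2 / γ)).toNNReal P := by
  have h := hν.hasSubgaussianMGF hγ hmean
  rw [← hZ.map_eq, HasSubgaussianMGF.id_map_iff hZ.aemeasurable] at h
  have h' := h.const_mul σ
  convert! h' using 1
  · ext ω
    field_simp
  · rw [Real.toNNReal_mul (sq_nonneg σ)]
    congr 1
    exact Real.toNNReal_of_nonneg (sq_nonneg σ)

/-- Two-sided Hoeffding bound for weighted sums of independent sub-Gaussian variables. -/
theorem measureReal_lt_abs_sum_mul_le {ι : Type*} [Fintype ι] {Z : ι → Ω → ℝ}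
    (hindep : iIndepFun Z P) {c : NNReal} (hZ : ∀ i, HasSubgaussianMGF (Z i) c P)
    (a : ι → ℝ) {τ : ℝ} (hτ : 0 ≤ τ) :
    P.real {ω | τ < |∑ i, a i * Z i ω|} ≤
      2 * Real.exp (-τ ^ 2 / (2 * ((∑ i, a i ^ 2) * c))) := by
  have := hindep.isProbabilityMeasure
  have hsum := HasSubgaussianMGF.sum_of_iIndepFun (s := Finset.univ)
    (hindep.comp (fun i x => a i * x) fun i => by fun_prop)
    fun i _ => (hZ i).const_mul (a i)
  have hpos := hsum.measure_ge_le hτ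
  have hneg := hsum.neg.measure_ge_le hτ
  have hc : ((∑ i : ι, (⟨a i ^ 2, sq_nonneg (a i)⟩ * c : NNReal) : NNReal) : ℝ)
      = (∑ i, a i ^ 2) * c := by
    rw [NNReal.coe_sum, Finset.sum_mul]
    rfl
  rw [hc] at hpos hneg
  refine (measureReal_mono ?_).trans ((measureReal_union_le _ _).trans
    ((add_le_add hpos hneg).trans_eq (two_mul _).symm))
  intro ω hω
  rcases lt_abs.1 (show τ < |∑ i, a i * Z i ω| from hω) with h | h
  · exact Or.inl h.le
  · exact Or.inr h.le

end Noise

/-! ### Deterministic analysis of the Lasso -/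

section Deterministic

variable {n p : ℕ}

theorem sqL2Norm_nonneg {m : ℕ} (b : Fin m → ℝ) : 0 ≤ sqL2Norm b :=
  Finset.sum_nonneg fun _ _ => sq_nonneg _

theorem l1Norm_eq_sum_add_sum_compl (S : Finset (Fin p)) (b : Fin p → ℝ) :
    l1Norm b = ∑ j ∈ S, |b j| + ∑ j ∈ Sᶜ, |b j| :=
  (Finset.sum_add_sum_compl S _).symm

theorem l1Norm_add_le {m : ℕ} (s t : ℝ) (hs : 0 ≤ s) (ht : 0 ≤ t) (a b : Fin m → ℝ) :
    l1Norm (s • a + t • b) ≤ s * l1Norm a + t * l1Norm b := by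
  simp only [l1Norm, Finset.mul_sum, ← Finset.sum_add_distrib]
  refine Finset.sum_le_sum fun j _ => (abs_add_le _ _).trans_eq ?_
  simp [abs_mul, abs_of_nonneg hs, abs_of_nonneg ht]

theorem sqL2Norm_sub_smul {m : ℕ} (s : ℝ) (w v : Fin m → ℝ) :
    sqL2Norm (w - s • v) = sqL2Norm w - 2 * s * (w ⬝ᵥ v) + s ^ 2 * sqL2Norm v := by
  simp only [sqL2Norm, dotProduct, Finset.mul_sum, ← Finset.sum_add_distrib,
    ← Finset.sum_sub_distrib]
  refine Finset.sum_congr rfl fun i _ => ?_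
  simp only [Pi.sub_apply, Pi.smul_apply, smul_eq_mul]
  ring

/-- The optimality inequality for the Lasso, strengthened by the strong convexity of the
quadratic loss in `X β`. -/
theorem IsLassoEstimate.sqL2Norm_le {X : Matrix (Fin n) (Fin p) ℝ} {y : Fin n → ℝ} {lam : ℝ}
    (hlam : 0 ≤ lam) {b : Fin p → ℝ} (hb : IsLassoEstimate X y lam b) (β : Fin p → ℝ) :
    1 / (n : ℝ) * sqL2Norm (X *ᵥ (b - β)) ≤
      1 / (n : ℝ) * ((y - X *ᵥ β) ⬝ᵥ (X *ᵥ (b - β))) + lam * (l1Norm β - l1Norm b) := by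
  set v := X *ᵥ (b - β)
  set w := y - X *ᵥ β
  have hres : ∀ s : ℝ, y - X *ᵥ (s • b + (1 - s) • β) = w - s • v := by
    intro s
    simp only [v, w, mulVec_add, mulVec_smul, mulVec_sub]
    module
  -- Compare `b` with a point of the segment to `β` and divide by `1 - s`: the quadratic coefficient
  -- `(1 - s ^ 2) / 2` becomes `(1 + s) / 2`, which tends to 1. Comparing with `β` itself would give
  -- only `1 / 2`.
  have key : ∀ s ∈ Set.Ioo (0 : ℝ) 1, 1 / (n : ℝ) * ((1 + s) / 2 * sqL2Norm v) ≤
      1 / (n : ℝ) * (w ⬝ᵥ v) + lam * (l1Norm β - l1Norm b) := by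
    rintro s ⟨hs0, hs1⟩
    have h := hb (s • b + (1 - s) • β)
    have h1 := hres 1
    simp only [one_smul, sub_self, zero_smul, add_zero] at h1
    have hw1 := sqL2Norm_sub_smul 1 w v
    rw [one_smul] at hw1
    rw [hres s, h1, hw1, sqL2Norm_sub_smul] at h
    have hl := mul_le_mul_of_nonneg_left
      (l1Norm_add_le s (1 - s) hs0.le (by linarith) b β) hlam
    have hn : 1 / (2 * (n : ℝ)) = 1 / 2 * (1 / n) := by rw [one_div_mul_one_div]
    rw [hn] at h
    have h1s : 0 < 1 - s := by linarith
    refine le_of_mul_le_mul_left ?_ h1s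
    nlinarith
  have := le_of_forall_mem_Ioo_le_of_continuous (by fun_prop) key
  norm_num at this ⊢
  exact this

theorem l1Norm_sub_le_of_support (β b : Fin p → ℝ) :
    l1Norm β - l1Norm b ≤ ∑ j ∈ coefSupport β, |(b - β) j| -
      ∑ j ∈ (coefSupport β)ᶜ, |(b - β) j| := by
  have hc : ∀ j ∈ (coefSupport β)ᶜ, β j = 0 := fun j hj => by simpa [coefSupport] using hj
  rw [l1Norm_eq_sum_add_sum_compl (coefSupport β) β, l1Norm_eq_sum_add_sum_compl (coefSupport β) b]
  have h1 : ∑ j ∈ (coefSupport β)ᶜ, |β j| = 0 :=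
    Finset.sum_eq_zero fun j hj => by rw [hc j hj, abs_zero]
  have h2 : ∑ j ∈ (coefSupport β)ᶜ, |(b - β) j| = ∑ j ∈ (coefSupport β)ᶜ, |b j| :=
    Finset.sum_congr rfl fun j hj => by rw [Pi.sub_apply, hc j hj, sub_zero]
  have h3 : ∑ j ∈ coefSupport β, |β j| ≤
      ∑ j ∈ coefSupport β, |b j| + ∑ j ∈ coefSupport β, |(b - β) j| := by
    rw [← Finset.sum_add_distrib]
    refine Finset.sum_le_sum fun j _ => ?_
    have := abs_sub_abs_le_abs_sub (β j) (b j)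
    rw [abs_sub_comm] at this
    simp only [Pi.sub_apply]
    linarith
  linarith

theorem KKTCondition.dotProduct_le {X : Matrix (Fin n) (Fin p) ℝ} {y : Fin n → ℝ} {lam : ℝ}
    {β : Fin p → ℝ} (h : KKTCondition X y lam β) (d : Fin p → ℝ) :
    1 / (n : ℝ) * ((y - X *ᵥ β) ⬝ᵥ (X *ᵥ d)) ≤ lam / 2 * l1Norm d := by
  rw [dotProduct_mulVec, ← mulVec_transpose, ← smul_eq_mul, ← smul_dotProduct, dotProduct, l1Norm,
    Finset.mul_sum]
  refine Finset.sum_le_sum fun j _ => (le_abs_self _).trans ?_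
  rw [abs_mul]
  exact mul_le_mul_of_nonneg_right ((norm_le_pi_norm _ j).trans h) (abs_nonneg _)

theorem KKTCondition.nonneg {X : Matrix (Fin n) (Fin p) ℝ} {y : Fin n → ℝ} {lam : ℝ}
    {β : Fin p → ℝ} (h : KKTCondition X y lam β) : 0 ≤ lam := by
  have := (norm_nonneg _).trans h
  linarith

/-- The noise term costs `lam / 2` on every coordinate, and the penalty difference contributes `lam`
on the support and `-lam` off it; the sums are `3 / 2` and `-1 / 2`. -/
theorem IsLassoEstimate.basic_inequality {X : Matrix (Fin n) (Fin p) ℝ} {y : Fin n → ℝ} {lam : ℝ}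
    {b β : Fin p → ℝ} (hb : IsLassoEstimate X y lam b) (h : KKTCondition X y lam β) :
    2 * (1 / (n : ℝ) * sqL2Norm (X *ᵥ (b - β))) + lam * ∑ j ∈ (coefSupport β)ᶜ, |(b - β) j| ≤
      lam * (3 * ∑ j ∈ coefSupport β, |(b - β) j|) := by
  have h1 := hb.sqL2Norm_le h.nonneg β
  have h2 := h.dotProduct_le (b - β)
  have h3 := mul_le_mul_of_nonneg_left (l1Norm_sub_le_of_support β b) h.nonneg
  rw [l1Norm_eq_sum_add_sum_compl (coefSupport β) (b - β)] at h2
  linarith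

theorem dotProduct_gramMatrix_mulVec (X : Matrix (Fin n) (Fin p) ℝ) (d : Fin p → ℝ) :
    d ⬝ᵥ (gramMatrix X *ᵥ d) = 1 / (n : ℝ) * sqL2Norm (X *ᵥ d) := by
  rw [gramMatrix, smul_mulVec, dotProduct_smul, smul_eq_mul, ← mulVec_mulVec, dotProduct_mulVec,
    vecMul_transpose]
  simp [sqL2Norm, dotProduct, sq]

theorem sq_mul_sqL2Norm_le_of_le_restrictedEigenvalue {S : Finset (Fin p)} {γ η : ℝ} (hγ : 0 ≤ γ)
    {X : Matrix (Fin n) (Fin p) ℝ} (h : (γ : EReal) ≤ restrictedEigenvalue η S (gramMatrix X))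
    {d : Fin p → ℝ} (hd : d ∈ lassoCone η S) :
    γ ^ 2 * sqL2Norm d ≤ 1 / (n : ℝ) * sqL2Norm (X *ᵥ d) := by
  have hq : 0 ≤ 1 / (n : ℝ) * sqL2Norm (X *ᵥ d) := mul_nonneg (by positivity) (sqL2Norm_nonneg _)
  rcases eq_or_lt_of_le (sqL2Norm_nonneg d) with h0 | h0
  · rwa [← h0, mul_zero]
  have hd0 : d ≠ 0 := by
    rintro rfl
    simp [sqL2Norm] at h0
  have h1 : (γ : EReal) ≤ _ := h.trans (iInf₂_le d ⟨hd0, hd⟩)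
  rw [EReal.coe_le_coe_iff, dotProduct_gramMatrix_mulVec, le_div_iff₀ (Real.sqrt_pos.2 h0)] at h1
  have h2 := pow_le_pow_left₀ (mul_nonneg hγ (Real.sqrt_nonneg _)) h1 2
  rwa [mul_pow, Real.sq_sqrt h0.le, Real.sq_sqrt hq] at h2

/-- Under the KKT condition with a positive penalty, the Lasso estimation error lies in the cone
`C(3, S)`. -/
theorem IsLassoEstimate.sub_mem_lassoCone {X : Matrix (Fin n) (Fin p) ℝ} {y : Fin n → ℝ} {lam : ℝ}
    {b β : Fin p → ℝ} (hb : IsLassoEstimate X y lam b) (h : KKTCondition X y lam β)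
    (hlam : 0 < lam) : b - β ∈ lassoCone 3 (coefSupport β) := by
  have h1 := hb.basic_inequality h
  have h2 : 0 ≤ 1 / (n : ℝ) * sqL2Norm (X *ᵥ (b - β)) :=
    mul_nonneg (by positivity) (sqL2Norm_nonneg _)
  exact le_of_mul_le_mul_left (by linarith) hlam

/-- With one normalized column and no penalty, a Lasso estimate satisfying the KKT condition is
exact. -/
theorem IsLassoEstimate.eq_of_subsingleton {X : Matrix (Fin n) (Fin p) ℝ} {y : Fin n → ℝ}
    {b β : Fin p → ℝ} (hp : p ≤ 1) (hX : ∀ j, 1 / (n : ℝ) * ∑ i, X i j ^ 2 = 1)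
    (hb : IsLassoEstimate X y 0 b) (h : KKTCondition X y 0 β) : b = β := by
  have : Subsingleton (Fin p) := Fin.subsingleton_iff_le_one.2 hp
  ext j
  have h1 := hb.basic_inequality h
  have hcol : ∀ i, (X *ᵥ (b - β)) i = X i j * (b - β) j := fun i => by
    rw [mulVec, dotProduct, Fintype.sum_eq_single j fun k hk => (hk (Subsingleton.elim k j)).elim]
  have h2 : 1 / (n : ℝ) * sqL2Norm (X *ᵥ (b - β)) = (b - β) j ^ 2 := by
    simp only [sqL2Norm, hcol, mul_pow, ← Finset.sum_mul]
    rw [← mul_assoc, hX j, one_mul]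
  rw [h2, zero_mul, zero_mul, add_zero] at h1
  have h3 : (b - β) j = 0 := pow_eq_zero_iff two_ne_zero |>.1 (by nlinarith [sq_nonneg ((b - β) j)])
  simpa [sub_eq_zero] using h3

/-- Oracle inequalities for the Lasso under a restricted eigenvalue condition. -/
theorem IsLassoEstimate.oracle_inequalities {X : Matrix (Fin n) (Fin p) ℝ} {y : Fin n → ℝ}
    {lam γ : ℝ} {b β : Fin p → ℝ} (hb : IsLassoEstimate X y lam b) (h : KKTCondition X y lam β)
    (hlam : 0 < lam) (hγ : 0 < γ)
    (hRE : (γ : EReal) ≤ restrictedEigenvalue 3 (coefSupport β) (gramMatrix X)) :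
    l1Norm (b - β) ≤ 3 * lam / γ ^ 2 * (coefSupport β).card ∧
      sqL2Norm (b - β) ≤ 9 * lam ^ 2 / γ ^ 4 * (coefSupport β).card ∧
      1 / (n : ℝ) * sqL2Norm (X *ᵥ (b - β)) ≤ 9 * lam ^ 2 / γ ^ 2 * (coefSupport β).card := by
  have hbasic := hb.basic_inequality h
  have hre := sq_mul_sqL2Norm_le_of_le_restrictedEigenvalue hγ.le hRE
    (hb.sub_mem_lassoCone h hlam)
  have hu : 0 ≤ 1 / (n : ℝ) * sqL2Norm (X *ᵥ (b - β)) :=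
    mul_nonneg (by positivity) (sqL2Norm_nonneg _)
  have hl1 := l1Norm_eq_sum_add_sum_compl (coefSupport β) (b - β)
  have hcs : (∑ j ∈ coefSupport β, |(b - β) j|) ^ 2 ≤
      (coefSupport β).card * sqL2Norm (b - β) := by
    refine sq_sum_le_card_mul_sum_sq.trans (mul_le_mul_of_nonneg_left ?_ (Nat.cast_nonneg _))
    simp only [sq_abs]
    exact Finset.sum_le_univ_sum_of_nonneg fun j => sq_nonneg _
  have hq0 : 0 ≤ ∑ j ∈ coefSupport β, |(b - β) j| := Finset.sum_nonneg fun _ _ => abs_nonneg _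
  have hr0 : 0 ≤ ∑ j ∈ (coefSupport β)ᶜ, |(b - β) j| := Finset.sum_nonneg fun _ _ => abs_nonneg _
  have hs0 : (0 : ℝ) ≤ (coefSupport β).card := Nat.cast_nonneg _
  generalize 1 / (n : ℝ) * sqL2Norm (X *ᵥ (b - β)) = U at *
  generalize sqL2Norm (b - β) = D at *
  generalize (∑ j ∈ coefSupport β, |(b - β) j|) = q at *
  generalize (∑ j ∈ (coefSupport β)ᶜ, |(b - β) j|) = r at *
  generalize ((coefSupport β).card : ℝ) = s at *
  have hγ2 : 0 < γ ^ 2 := by positivity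
  -- From here on only scalars: `U` is the prediction error, `D` the squared error, `q` and `r` the
  -- ℓ₁ errors on and off the support, `s` the sparsity.
  have hq : γ ^ 2 * q ^ 2 ≤ s * U := by nlinarith
  have hUq : U ≤ 3 / 2 * lam * q := by nlinarith
  have hU : γ ^ 2 * U ≤ 9 / 4 * lam ^ 2 * s := by
    rcases hu.eq_or_lt with h0 | h0
    · rw [← h0, mul_zero]; positivity
    · refine le_of_mul_le_mul_right ?_ h0
      calc γ ^ 2 * U * U = γ ^ 2 * U ^ 2 := by ring
        _ ≤ γ ^ 2 * (3 / 2 * lam * q) ^ 2 := by gcongr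
        _ = 9 / 4 * lam ^ 2 * (γ ^ 2 * q ^ 2) := by ring
        _ ≤ 9 / 4 * lam ^ 2 * (s * U) := by gcongr
        _ = _ := by ring
  -- From `(γ ^ 2 * q - lam * s) ^ 2 ≥ 0` and `hq`, after dividing by `s`. Applied twice to `lam *
  -- (q + r) ≤ 4 * lam * q - 2 * U`, it cancels `U` and leaves the ℓ₁ constant 2; without the
  -- doubled `U` it would be 4, above the required 3.
  have hlq : 2 * lam * q * γ ^ 2 ≤ U * γ ^ 2 + lam ^ 2 * s := by
    rcases hs0.eq_or_lt with h0 | h0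
    · have : q = 0 := by
        rw [← h0, zero_mul] at hq
        have : q ^ 2 ≤ 0 := by nlinarith
        exact pow_eq_zero_iff two_ne_zero |>.1 (le_antisymm this (sq_nonneg q))
      rw [this, ← h0]
      simp only [mul_zero, zero_mul, add_zero]
      positivity
    · refine le_of_mul_le_mul_right ?_ h0
      nlinarith [sq_nonneg (γ ^ 2 * q - lam * s), mul_le_mul_of_nonneg_left hq hγ2.le]
  refine ⟨?_, ?_, ?_⟩
  · rw [hl1, div_mul_eq_mul_div, le_div_iff₀ hγ2]
    refine le_of_mul_le_mul_left ?_ hlam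
    nlinarith [mul_nonneg (sq_nonneg lam) hs0, mul_le_mul_of_nonneg_right hbasic hγ2.le]
  · rw [div_mul_eq_mul_div, le_div_iff₀ (by positivity)]
    nlinarith [mul_nonneg (sq_nonneg lam) hs0, mul_le_mul_of_nonneg_left hre hγ2.le]
  · rw [div_mul_eq_mul_div, le_div_iff₀ hγ2]
    nlinarith [mul_nonneg (sq_nonneg lam) hs0]

theorem not_kktCondition_iff {X : Matrix (Fin n) (Fin p) ℝ} {y : Fin n → ℝ} {lam : ℝ}
    (hlam : 0 ≤ lam) {β : Fin p → ℝ} : ¬ KKTCondition X y lam β ↔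
      ∃ j, lam / 2 < |∑ i, 1 / (n : ℝ) * X i j * (y - X *ᵥ β) i| := by
  rw [KKTCondition, pi_norm_le_iff_of_nonneg (by positivity)]
  simp [mulVec, dotProduct, Finset.mul_sum, mul_assoc]

theorem natCast_pos_of_normalized {X : Matrix (Fin n) (Fin p) ℝ}
    (hX : ∀ j, 1 / (n : ℝ) * ∑ i, X i j ^ 2 = 1) (j : Fin p) : (0 : ℝ) < n := by
  rcases Nat.eq_zero_or_pos n with rfl | h
  · simpa using hX j
  · exact_mod_cast h

end Deterministic

/-! ### Probability of the KKT event and the theorem -/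

/-- The KKT condition holds at the true coefficients with high probability. -/
theorem measureReal_not_kktCondition_le {Ω : Type*} [MeasurableSpace Ω] {P : Measure Ω}
    {n p : ℕ} {X : Matrix (Fin n) (Fin p) ℝ} {β : Fin p → ℝ} {σ A lam : ℝ} (hσ : 0 < σ)
    (hA : 0 ≤ A) (hX : ∀ j, 1 / (n : ℝ) * ∑ i, X i j ^ 2 = 1) (hp : 0 < p)
    {ε : Fin n → Ω → ℝ} (hindep : iIndepFun ε P)
    (hε : ∀ i, HasSubgaussianMGF (ε i) (σ ^ 2).toNNReal P)
    {Y : Ω → Fin n → ℝ} (hY : ∀ ω, Y ω = X *ᵥ β + fun i => ε i ω)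
    (hlam : lam = A * σ * Real.sqrt (Real.log p / n)) :
    P.real {ω | ¬ KKTCondition X (Y ω) lam β} ≤ 2 * (p : ℝ) ^ (1 - A ^ 2 / 8) := by
  have hn : (0 : ℝ) < n := natCast_pos_of_normalized hX ⟨0, hp⟩
  have hp' : (0 : ℝ) < p := by exact_mod_cast hp
  have hlam0 : 0 ≤ lam := by rw [hlam]; positivity
  have := hindep.isProbabilityMeasure
  have hset : {ω | ¬ KKTCondition X (Y ω) lam β} ⊆
      ⋃ j ∈ Finset.univ, {ω | lam / 2 < |∑ i, 1 / (n : ℝ) * X i j * ε i ω|} := by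
    intro ω hω
    obtain ⟨j, hj⟩ := (not_kktCondition_iff hlam0).1 hω
    simp only [Finset.mem_univ, Set.iUnion_true, Set.mem_iUnion]
    refine ⟨j, ?_⟩
    simpa [hY] using hj
  have hj : ∀ j, P.real {ω | lam / 2 < |∑ i, 1 / (n : ℝ) * X i j * ε i ω|} ≤
      2 * (p : ℝ) ^ (-(A ^ 2 / 8)) := by
    intro j
    refine (measureReal_lt_abs_sum_mul_le hindep hε _ (by positivity)).trans_eq ?_
    -- Column normalization makes the variance proxy `σ ^ 2 / n`, so at level `lam / 2` the
    -- Hoeffding exponent is `-(A ^ 2 / 8) * log p`.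
    have ha : ∑ i, (1 / (n : ℝ) * X i j) ^ 2 = 1 / (n : ℝ) := by
      simp only [mul_pow, ← Finset.mul_sum]
      rw [sq (1 / (n : ℝ)), mul_assoc, hX j, mul_one]
    have hl : lam ^ 2 = A ^ 2 * σ ^ 2 * (Real.log p / n) := by
      rw [hlam, mul_pow, mul_pow,
        Real.sq_sqrt (div_nonneg (Real.log_natCast_nonneg p) hn.le)]
    rw [ha, Real.coe_toNNReal _ (sq_nonneg σ), Real.rpow_def_of_pos hp', div_pow, hl]
    congr 2
    field_simp
    norm_num
  calc P.real {ω | ¬ KKTCondition X (Y ω) lam β}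
      ≤ ∑ j, P.real {ω | lam / 2 < |∑ i, 1 / (n : ℝ) * X i j * ε i ω|} :=
        (measureReal_mono hset (measure_ne_top _ _)).trans (measureReal_biUnion_finset_le _ _)
    _ ≤ ∑ _j : Fin p, 2 * (p : ℝ) ^ (-(A ^ 2 / 8)) := Finset.sum_le_sum fun j _ => hj j
    _ = 2 * (p : ℝ) ^ (1 - A ^ 2 / 8) := by
        rw [Finset.sum_const, Finset.card_univ, Fintype.card_fin, nsmul_eq_mul, sub_eq_add_neg,
          Real.rpow_add hp', Real.rpow_one]
        ring

theorem mainTheorem6 {Ω : Type*} [MeasurableSpace Ω] (P : Measure Ω) [IsProbabilityMeasure P]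
    (n p : ℕ) (X : Matrix (Fin n) (Fin p) ℝ) (βstar : Fin p → ℝ)
    (σ A lam : ℝ) (hσ : 0 < σ) (hA : 0 < A)
    -- normalized columns
    (hX : ∀ j, 1 / (n : ℝ) * ∑ i, X i j ^ 2 = 1)
    -- independent, identically distributed errors, Gaussian or (after division by `σ`)
    -- centred and 2-strongly log-concave
    (ε : Fin n → Ω → ℝ) (hindep : iIndepFun ε P)
    (hε : (∀ i, HasLaw (ε i) (gaussianReal 0 (σ ^ 2).toNNReal) P) ∨
      ∃ ν : Measure ℝ, IsStronglyLogConcaveLaw 2 ν ∧ ∫ x, x ∂ν = 0 ∧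
        ∀ i, HasLaw (fun ω => ε i ω / σ) ν P)
    -- the linear model
    (Y : Ω → Fin n → ℝ) (hY : ∀ ω, Y ω = X *ᵥ βstar + fun i => ε i ω)
    (hlam : lam = A * σ * Real.sqrt (Real.log p / n)) :
    -- (1) cone membership whenever the KKT condition holds
    (∀ ω, KKTCondition X (Y ω) lam βstar →
      ∀ b, IsLassoEstimate X (Y ω) lam b → b - βstar ∈ lassoCone 3 (coefSupport βstar)) ∧
    -- (2) oracle inequalities with high probability
    (2 * Real.sqrt 2 < A → ∀ γ : ℝ, 0 < γ →
      (γ : EReal) ≤ restrictedEigenvalue 3 (coefSupport βstar) (gramMatrix X) →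
      1 - 2 * (p : ℝ) ^ (1 - A ^ 2 / 8) ≤
        P.real {ω | KKTCondition X (Y ω) lam βstar ∧
          ∀ b, IsLassoEstimate X (Y ω) lam b →
            l1Norm (b - βstar) ≤
              3 * A * σ / γ ^ 2 *
                ((coefSupport βstar).card * Real.sqrt (Real.log p / n)) ∧
            sqL2Norm (b - βstar) ≤
              9 * A ^ 2 * σ ^ 2 / γ ^ 4 *
                ((coefSupport βstar).card * Real.log p / n) ∧
            1 / (n : ℝ) * sqL2Norm (X *ᵥ (b - βstar)) ≤
              9 * A ^ 2 * σ ^ 2 / γ ^ 2 *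
                ((coefSupport βstar).card * Real.log p / n)}) := by
  have hlam0 : 0 ≤ lam := by rw [hlam]; positivity
  have hlampos : 2 ≤ p → 0 < lam := by
    intro hp
    have hn : (0 : ℝ) < n := natCast_pos_of_normalized hX ⟨0, by omega⟩
    have hlog : 0 < Real.log p := Real.log_pos (by exact_mod_cast hp)
    rw [hlam]
    positivity
  refine ⟨fun ω hK b hb => ?_, fun hA8 γ hγ hRE => ?_⟩
  · rcases Nat.lt_or_ge p 2 with hp | hp
    -- For `p ≤ 1` the penalty vanishes and cannot be divided out, so the cone is reached through
    -- exact recovery.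
    · have hl : lam = 0 := by
        have : Real.log p = 0 := by interval_cases p <;> simp
        rw [hlam, this]; simp
      rw [hl] at hK hb
      rw [hb.eq_of_subsingleton (by omega) hX hK]
      simp [lassoCone]
    · exact hb.sub_mem_lassoCone hK (hlampos hp)
  have hA2 : 8 < A ^ 2 := by
    have := pow_lt_pow_left₀ hA8 (by positivity) two_ne_zero
    rw [mul_pow, Real.sq_sqrt zero_le_two] at this
    linarith
  rcases Nat.lt_or_ge p 2 with hp | hp
  · interval_cases p
    -- For `p = 0` the exponent is nonzero, so the power is 0 and the event must have full
    -- probability; it does, trivially. For `p = 1` the lower bound is `-1`.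
    · rw [Nat.cast_zero, Real.zero_rpow (by linarith), mul_zero, sub_zero]
      refine (probReal_univ (μ := P)).symm.le.trans (measureReal_mono fun ω _ => ⟨?_, ?_⟩)
      · rw [KKTCondition, pi_norm_le_iff_of_nonneg (by positivity)]
        exact fun j => j.elim0
      · intro b _
        rw [Subsingleton.elim (b - βstar) 0]
        simp [l1Norm, sqL2Norm]
    · refine le_trans ?_ measureReal_nonneg
      norm_num
  · have hsub : ∀ i, HasSubgaussianMGF (ε i) (σ ^ 2).toNNReal P := by
      rcases hε with hε | ⟨ν, hν, hmean, hε⟩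
      · exact fun i => hasSubgaussianMGF_of_hasLaw_gaussianReal (hε i)
      · intro i
        simpa using hasSubgaussianMGF_of_hasLaw_stronglyLogConcave hσ.ne' two_pos hν hmean (hε i)
    have hbad := measureReal_not_kktCondition_le hσ hA.le hX (by omega) hindep hsub hY hlam
    -- Subadditivity suffices here, so measurability of the KKT event is not needed.
    have hsplit : 1 ≤ P.real {ω | KKTCondition X (Y ω) lam βstar} +
        P.real {ω | ¬ KKTCondition X (Y ω) lam βstar} := by
      rw [← probReal_univ (μ := P),
        ← Set.union_compl_self {ω | KKTCondition X (Y ω) lam βstar}]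
      exact measureReal_union_le _ _
    refine (show _ ≤ P.real {ω | KKTCondition X (Y ω) lam βstar} by linarith).trans
      (measureReal_mono fun ω hK => ⟨hK, fun b hb => ?_⟩)
    have hl : lam ^ 2 = A ^ 2 * σ ^ 2 * (Real.log p / n) := by
      rw [hlam, mul_pow, mul_pow,
        Real.sq_sqrt (div_nonneg (Real.log_natCast_nonneg p) (Nat.cast_nonneg n))]
    obtain ⟨h1, h2, h3⟩ := hb.oracle_inequalities hK (hlampos hp) hγ hRE
    refine ⟨h1.trans_eq ?_, h2.trans_eq ?_, h3.trans_eq ?_⟩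
    · rw [hlam]; ring
    · rw [hl]; ring
    · rw [hl]; ring
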